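/- Let $X$ be a continuum, i.e. a nonempty compact connected metric space; by a subcontinuum of $X$ we mean a nonempty compact connected subset, and a set is nondegenerate if it has more than one point. Suppose that - $X$ is irreducible: $X$ is nondegenerate and there are points $a,b\in X$ such that the only subcontinuum of $X$ containing both $a$ and $b$ is $X$ itself; and - $X$ is a $D^{**}$-continuum: for all disjoint nondegenerate subcontinua $A,B\subseteq X$ there is a subcontinuum $C\subseteq X$ with $A\cap C\neq\emptyset$, $B\cap C\neq\emptyset$ and $B\setminus C\neq\emptyset$. Then $X$ is an arc, i.e. $X$ is homeomorphic to $[0,1]$. -/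

import Mathlib

/-- A subcontinuum of a metric space: a nonempty compact connected subset
(`IsConnected` includes nonemptiness). -/
def IsSubcontinuum {X : Type*} [TopologicalSpace X] (C : Set X) : Prop :=
  IsCompact C ∧ IsConnected C

/-- The `D**` property: for any two disjoint nondegenerate subcontinua `A`, `B` (in this order)
some subcontinuum `C` meets both `A` and `B` and does not contain all of `B`. -/
def IsDStarStar (X : Type*) [TopologicalSpace X] : Prop :=
  ∀ A B : Set X, IsSubcontinuum A → A.Nontrivial → IsSubcontinuum B → B.Nontrivial →
    Disjoint A B →
      ∃ C : Set X, IsSubcontinuum C ∧ (A ∩ C).Nonempty ∧ (B ∩ C).Nonempty ∧ (B \ C).Nonempty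

/-- `X` is irreducible between `a` and `b`: the only subcontinuum of `X` containing both points
is `X` itself. -/
def IsIrreducibleBetween (X : Type*) [TopologicalSpace X] (a b : X) : Prop :=
  ∀ C : Set X, IsSubcontinuum C → a ∈ C → b ∈ C → C = Set.univ

/-- An irreducible continuum is nondegenerate and irreducible between some two of its points
(which are then automatically distinct). -/
def IsIrreducibleContinuum (X : Type*) [TopologicalSpace X] : Prop :=
  Nontrivial X ∧ ∃ a b : X, IsIrreducibleBetween X a b

/-- An arc is a space homeomorphic to `[0,1]`. -/
def IsArc (X : Type*) [TopologicalSpace X] : Prop :=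
  Nonempty (X ≃ₜ unitInterval)

/-!
Fix points `a`, `b` between which `X` is irreducible. The complement of a subcontinuum through `b`
is connected, so its closure is a subcontinuum whenever it is nonempty.

The `D**` property enters only once, to show that every nondegenerate subcontinuum `T` has interior
points (`IsDStarStar.interior_nonempty`). If `T` is nowhere dense and meets a subcontinuum
`B ∋ b` with `a ∉ T ∪ B`, then `T ⊆ B`: otherwise `D**` joins a small continuum `Q ∋ a` to
some continuum `P ⊆ T \ B` by a continuum `C` not containing `P`, but `Q ∪ C ∪ T ∪ B = X` by
irreducibility, and the nowhere dense `T` can be dropped, so `P ⊆ C`. The same statement with `a`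
and `b` exchanged contradicts `D**` for a small continuum containing `a` and `T`.

Since a small nondegenerate continuum now has interior, removing it makes a continuum smaller even
after taking closures. Together with irreducibility this shows that a proper subcontinuum
containing `b` has a one-point boundary, and that a subcontinuum `B p` minimal with respect to
containing `p` and `b` has boundary `p`. Thus `X` is the union of two subcontinua `A p ∋ a` and
`B p ∋ b` meeting only in `p` (`IsIrreducibleBetween.exists_isCut`).

The sets `A p` are then totally ordered by inclusion and vary continuously with `p` in the
Hausdorff sense, so `p ↦ ∑ₙ 2⁻ⁿ infDist zₙ (A p)`, with `zₙ` a dense sequence, is a continuous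
injection of `X` into `ℝ` (`IsIrreducibleBetween.exists_continuous_injective`), whose image is a
compact interval.
-/

section Continua

open Set Topology

variable {X : Type*} [MetricSpace X]

/-! ### Continua: boundary bumping, nested intersections, complements -/

/-- Boundary bumping: every point of a nondegenerate continuum lies in arbitrarily small
nondegenerate subcontinua. -/
theorem IsSubcontinuum.exists_nontrivial_subset {K U : Set X} (hK : IsSubcontinuum K)
    (hKn : K.Nontrivial) (hU : IsOpen U) {x : X} (hxK : x ∈ K) (hxU : x ∈ U) :
    ∃ P ⊆ K ∩ U, IsSubcontinuum P ∧ P.Nontrivial ∧ x ∈ P := by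
  obtain ⟨y, hyK, hyx⟩ := hKn.exists_ne x
  obtain ⟨ε, hε, hεU⟩ := Metric.isOpen_iff.1 hU x hxU
  obtain ⟨r, hr, hrε, hry⟩ : ∃ r > 0, r < ε ∧ r < dist y x := by
    obtain ⟨r, hr, hr'⟩ := exists_between (lt_min hε (dist_pos.2 hyx))
    exact ⟨r, hr, lt_of_lt_of_le hr' (min_le_left _ _), lt_of_lt_of_le hr' (min_le_right _ _)⟩
  set F : Set X := K ∩ Metric.closedBall x r
  have hF : IsCompact F := hK.1.inter_right Metric.isClosed_closedBall
  have : CompactSpace F := isCompact_iff_compactSpace.1 hF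
  let x' : F := ⟨x, hxK, Metric.mem_closedBall_self hr.le⟩
  have hPF : Subtype.val '' connectedComponent x' ⊆ F := by
    rintro _ ⟨z, -, rfl⟩
    exact z.2
  refine ⟨Subtype.val '' connectedComponent x', fun z hz => ⟨(hPF hz).1, hεU ?_⟩, ⟨?_, ?_⟩, ?_,
    ⟨x', mem_connectedComponent, rfl⟩⟩
  · exact lt_of_le_of_lt (Metric.mem_closedBall.1 (hPF hz).2) hrε
  · exact isClosed_connectedComponent.isCompact.image continuous_subtype_val
  · exact isConnected_connectedComponent.image _ continuous_subtype_val.continuousOn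
  by_contra hsub
  rw [Set.not_nontrivial_iff] at hsub
  -- A one-point component has a clopen neighbourhood inside the open ball; it is clopen in `K`.
  let O : Set F := Subtype.val ⁻¹' Metric.ball x r
  have hO : IsOpen O := Metric.isOpen_ball.preimage continuous_subtype_val
  have : Nonempty {s : Set F // IsClopen s ∧ x' ∈ s} := ⟨⟨univ, isClopen_univ, mem_univ _⟩⟩
  obtain ⟨⟨W, hW, hxW⟩, hWO⟩ : ∃ W : {s : Set F // IsClopen s ∧ x' ∈ s}, (W : Set F) ⊆ O := by
    refine exists_subset_nhds_of_isCompact ?_ (fun W => W.2.1.1.isCompact) ?_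
    · intro W₁ W₂
      exact ⟨⟨W₁ ∩ W₂, W₁.2.1.inter W₂.2.1, W₁.2.2, W₂.2.2⟩, inter_subset_left,
        inter_subset_right⟩
    · intro z hz
      rw [← connectedComponent_eq_iInter_isClopen] at hz
      have : (z : X) = x := hsub ⟨z, hz, rfl⟩ ⟨x', mem_connectedComponent, rfl⟩
      exact hO.mem_nhds (by simp [O, this, hr])
  obtain ⟨V, hV, hVW⟩ := isOpen_induced_iff.1 hW.2
  have hWc : IsClosed (Subtype.val '' W) :=
    (hW.1.isCompact.image continuous_subtype_val).isClosed
  have hWV : ∀ z ∈ K, z ∈ V ∩ Metric.ball x r ↔ z ∈ Subtype.val '' W := by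
    intro z hz
    constructor
    · rintro ⟨h1, h2⟩
      exact ⟨⟨z, hz, Metric.ball_subset_closedBall h2⟩, by rw [← hVW]; exact h1, rfl⟩
    · rintro ⟨w, hw, rfl⟩
      exact ⟨by rw [← hVW] at hw; exact hw, hWO hw⟩
  have key := isPreconnected_iff_subset_of_disjoint.1 hK.2.isPreconnected
    (V ∩ Metric.ball x r) (Subtype.val '' W)ᶜ (hV.inter Metric.isOpen_ball) hWc.isOpen_compl
    (fun z hz => by
      by_cases h : z ∈ Subtype.val '' W
      · exact Or.inl ((hWV z hz).2 h)
      · exact Or.inr h)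
    (by
      ext z
      simp only [mem_inter_iff, mem_empty_iff_false, iff_false]
      rintro ⟨hz, h1, h2⟩
      exact h2 ((hWV z hz).1 h1))
  rcases key with h | h
  · exact absurd (Metric.mem_ball.1 (h hyK).2) (not_lt.2 hry.le)
  · exact h hxK ⟨x', hxW, rfl⟩

/-- The intersection of a chain of continua is a continuum. -/
theorem IsSubcontinuum.sInter_of_isChain {c : Set (Set X)} (hc : c.Nonempty)
    (hchain : IsChain (· ⊆ ·) c) (h : ∀ C ∈ c, IsSubcontinuum C) : IsSubcontinuum (⋂₀ c) := by
  have : Nonempty c := hc.to_subtype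
  have hdir : DirectedOn (· ⊇ ·) c := fun A hA B hB => by
    rcases hchain.total hA hB with h | h
    · exact ⟨A, hA, Subset.rfl, h⟩
    · exact ⟨B, hB, h, Subset.rfl⟩
  have hclosed : IsClosed (⋂₀ c) := isClosed_sInter fun C hC => (h C hC).1.isClosed
  obtain ⟨C₀, hC₀⟩ := hc
  have hcomp : IsCompact (⋂₀ c) := (h C₀ hC₀).1.of_isClosed_subset hclosed (sInter_subset_of_mem hC₀)
  refine ⟨hcomp, ?_, ?_⟩
  · exact IsCompact.nonempty_sInter_of_directed_nonempty_isCompact_isClosed hdir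
      (fun C hC => (h C hC).2.nonempty) (fun C hC => (h C hC).1) (fun C hC => (h C hC).1.isClosed)
  rw [isPreconnected_iff_subset_of_disjoint_closed]
  intro u v hu hv huv hdis
  have hd : Disjoint (⋂₀ c ∩ u) (⋂₀ c ∩ v) := by
    rw [disjoint_iff_inter_eq_empty, ← hdis]
    ext z
    simp only [mem_inter_iff]
    tauto
  obtain ⟨U, V, hU, hV, huU, hvV, hUV⟩ :=
    SeparatedNhds.of_isCompact_isCompact (hcomp.inter_right hu) (hcomp.inter_right hv) hd
  obtain ⟨⟨C, hC⟩, hCUV⟩ : ∃ C : c, (C : Set X) ⊆ U ∪ V := by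
    refine exists_subset_nhds_of_isCompact (DirectedOn.directed_val hdir)
      (fun C => (h C C.2).1) fun z hz => (hU.union hV).mem_nhds ?_
    rw [← sInter_eq_iInter] at hz
    rcases huv hz with h | h
    · exact Or.inl (huU ⟨hz, h⟩)
    · exact Or.inr (hvV ⟨hz, h⟩)
  have hUVe : U ∩ V = ∅ := disjoint_iff_inter_eq_empty.1 hUV
  rcases isPreconnected_iff_subset_of_disjoint.1 (h C hC).2.isPreconnected U V hU hV hCUV
    (by rw [hUVe, inter_empty]) with h' | h'
  · refine Or.inl fun z hz => (huv hz).resolve_right fun hzv => ?_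
    exact hUV.le_bot ⟨h' (hz C hC), hvV ⟨hz, hzv⟩⟩
  · refine Or.inr fun z hz => (huv hz).resolve_left fun hzu => ?_
    exact hUV.le_bot ⟨huU ⟨hz, hzu⟩, h' (hz C hC)⟩

theorem IsSubcontinuum.union {A B : Set X} (hA : IsSubcontinuum A) (hB : IsSubcontinuum B)
    (h : (A ∩ B).Nonempty) : IsSubcontinuum (A ∪ B) :=
  ⟨hA.1.union hB.1, hA.2.union h hB.2⟩

/-- A continuum `P` together with one side `K \ U` of a separation of `K \ P` is connected. -/
theorem isPreconnected_union_diff {K P U V : Set X} (hK : IsClosed K) (hKc : IsPreconnected K)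
    (hP : IsSubcontinuum P) (hPK : P ⊆ K) (hU : IsOpen U) (hV : IsOpen V)
    (hcov : K \ P ⊆ U ∪ V) (hdis : (K \ P) ∩ (U ∩ V) = ∅) :
    IsPreconnected (P ∪ (K \ U)) := by
  have hdis' : ∀ z ∈ K, z ∉ P → z ∈ U → z ∈ V → False := fun z h1 h2 h3 h4 => by
    have : z ∈ (K \ P) ∩ (U ∩ V) := ⟨⟨h1, h2⟩, h3, h4⟩
    rw [hdis] at this
    exact this
  -- A closed piece of the union that misses `P` is clopen in `K`, hence empty.
  have key : ∀ t t' : Set X, IsClosed t → IsClosed t' → P ∪ (K \ U) ⊆ t ∪ t' →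
      (P ∪ (K \ U)) ∩ (t ∩ t') = ∅ → P ⊆ t → P ∪ (K \ U) ⊆ t := by
    intro t t' ht ht' hc hd hPt
    have hd' : ∀ z ∈ P ∪ (K \ U), z ∈ t → z ∈ t' → False := fun z h1 h2 h3 => by
      have : z ∈ (P ∪ (K \ U)) ∩ (t ∩ t') := ⟨h1, h2, h3⟩
      rw [hd] at this
      exact this
    have hKU : IsClosed (K \ U) := hK.sdiff hU
    have hKV : IsClosed (K \ V) := hK.sdiff hV
    have := isPreconnected_iff_subset_of_disjoint_closed.1 hKc
      ((P ∪ (K \ V)) ∪ ((K \ U) ∩ t)) ((K \ U) ∩ t')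
      ((hP.1.isClosed.union hKV).union (hKU.inter ht)) (hKU.inter ht')
      (by
        intro z hz
        by_cases h1 : z ∈ P
        · exact Or.inl (Or.inl (Or.inl h1))
        by_cases h2 : z ∈ V
        · have h3 : z ∈ K \ U := ⟨hz, fun h => hdis' z hz h1 h h2⟩
          rcases hc (Or.inr h3) with h | h
          · exact Or.inl (Or.inr ⟨h3, h⟩)
          · exact Or.inr ⟨h3, h⟩
        · exact Or.inl (Or.inl (Or.inr ⟨hz, h2⟩)))
      (by
        ext z
        simp only [mem_inter_iff, mem_empty_iff_false, iff_false]
        rintro ⟨hz, (h1 | h1) | h1, h2, h3⟩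
        · exact hd' z (Or.inl h1) (hPt h1) h3
        · by_cases hzP : z ∈ P
          · exact hd' z (Or.inl hzP) (hPt hzP) h3
          · rcases hcov ⟨hz, hzP⟩ with h | h
            · exact h2.2 h
            · exact h1.2 h
        · exact hd' z (Or.inr h2) h1.2 h3)
    rcases this with h | h
    · rintro z (hz | hz)
      · exact hPt hz
      · rcases h hz.1 with (h1 | h1) | h1
        · exact hPt h1
        · by_contra hzt
          by_cases hzP : z ∈ P
          · exact hzt (hPt hzP)
          · rcases hcov ⟨hz.1, hzP⟩ with h | h
            · exact hz.2 h
            · exact h1.2 h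
        · exact h1.2
    · obtain ⟨p, hp⟩ := hP.2.nonempty
      exact (hd' p (Or.inl hp) (hPt hp) (h (hPK hp)).2).elim
  rw [isPreconnected_iff_subset_of_disjoint_closed]
  intro t t' ht ht' hc hd
  rcases isPreconnected_iff_subset_of_disjoint_closed.1 hP.2.isPreconnected t t' ht ht'
    (subset_union_left.trans hc)
    (subset_empty_iff.1 (hd ▸ inter_subset_inter_left _ subset_union_left)) with h | h
  · exact Or.inl (key t t' ht ht' hc hd h)
  · exact Or.inr (key t' t ht' ht (by rwa [union_comm t' t]) (by rwa [inter_comm t' t]) h)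

/-- If no proper subcontinuum of `K` contains both `p` and `b`, then the complement in `K` of a
subcontinuum through `p` is connected. -/
theorem IsSubcontinuum.isPreconnected_diff {K P : Set X} {p b : X} (hK : IsSubcontinuum K)
    (hP : IsSubcontinuum P) (hPK : P ⊆ K) (hp : p ∈ P) (hb : b ∈ K)
    (hmin : ∀ C, IsSubcontinuum C → C ⊆ K → p ∈ C → b ∈ C → C = K) :
    IsPreconnected (K \ P) := by
  by_cases hbP : b ∈ P
  · rw [hmin P hP hPK hp hbP, sdiff_self]
    exact isPreconnected_empty
  have key : ∀ U V : Set X, IsOpen U → IsOpen V → K \ P ⊆ U ∪ V → (K \ P) ∩ (U ∩ V) = ∅ →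
      b ∈ V → K \ P ⊆ V := by
    intro U V hU hV hc hd hbV
    have hC : IsSubcontinuum (P ∪ (K \ U)) :=
      ⟨hP.1.union (hK.1.diff hU), ⟨p, Or.inl hp⟩,
        isPreconnected_union_diff hK.1.isClosed hK.2.isPreconnected hP hPK hU hV hc hd⟩
    have hbU : b ∉ U := fun h => by
      have : b ∈ (K \ P) ∩ (U ∩ V) := ⟨⟨hb, hbP⟩, h, hbV⟩
      rw [hd] at this
      exact this
    have h := hmin _ hC (union_subset hPK sdiff_subset) (Or.inl hp) (Or.inr ⟨hb, hbU⟩)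
    intro z hz
    rw [← h] at hz
    rcases hz with ⟨h1 | h1, h2⟩
    · exact (h2 h1).elim
    · exact (hc ⟨h1.1, h2⟩).resolve_left h1.2
  rw [isPreconnected_iff_subset_of_disjoint]
  intro U V hU hV hc hd
  rcases hc ⟨hb, hbP⟩ with h | h
  · exact Or.inl (key V U hV hU (by rwa [union_comm]) (by rwa [inter_comm V U]) h)
  · exact Or.inr (key U V hU hV hc hd h)

end Continua

section Irreducible

open Set Topology

variable {X : Type*} [MetricSpace X]

/-! ### Subcontinua of an irreducible `D**`-continuum have interior points -/

theorem IsIrreducibleBetween.symm {a b : X} (h : IsIrreducibleBetween X a b) :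
    IsIrreducibleBetween X b a :=
  fun C hC hb ha => h C hC ha hb

theorem isSubcontinuum_singleton (x : X) : IsSubcontinuum ({x} : Set X) :=
  ⟨isCompact_singleton, isConnected_singleton⟩

variable [CompactSpace X]

/-- A continuum `B` irreducible between `p` and `b` is not irreducible between `b` and any other
point `c` of `B`: the closure of what remains after removing a small continuum around `p` contains
both and is smaller by an open set. -/
theorem exists_isSubcontinuum_of_minimal
    (hint : ∀ T : Set X, IsSubcontinuum T → T.Nontrivial → (interior T).Nonempty)
    {p b c : X} {B : Set X}
    (hB : Minimal (fun C : Set X => IsSubcontinuum C ∧ p ∈ C ∧ b ∈ C) B) (hc : c ∈ B)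
    (hcp : c ≠ p) (hbp : b ≠ p) :
    ∃ E : Set X, IsSubcontinuum E ∧ b ∈ E ∧ c ∈ E ∧
      ∃ O ⊆ B, IsOpen O ∧ O.Nonempty ∧ Disjoint O E := by
  obtain ⟨hBc, hp, hb⟩ := hB.prop
  obtain ⟨P, hPB, hP, hPn, hpP⟩ := hBc.exists_nontrivial_subset ⟨b, hb, p, hp, hbp⟩
    (isOpen_compl_singleton.inter isOpen_compl_singleton) hp
    (show p ∈ ({c}ᶜ ∩ {b}ᶜ : Set X) from ⟨hcp.symm, hbp.symm⟩)
  have hbP : b ∈ B \ P := ⟨hb, fun h => (hPB h).2.2 rfl⟩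
  have hcP : c ∈ B \ P := ⟨hc, fun h => (hPB h).2.1 rfl⟩
  have h := hBc.isPreconnected_diff hP (fun z hz => (hPB hz).1) hpP hb
    fun C hC hCB hpC hbC => hB.eq_of_subset ⟨hC, hpC, hbC⟩ hCB
  refine ⟨closure (B \ P), ⟨isClosed_closure.isCompact, IsConnected.closure ⟨⟨b, hbP⟩, h⟩⟩,
    subset_closure hbP, subset_closure hcP, interior P,
    fun z hz => (hPB (interior_subset hz)).1, isOpen_interior, hint P hP hPn, ?_⟩
  exact Disjoint.closure_right
    (disjoint_left.2 fun z hz hz' => hz'.2 (interior_subset hz)) isOpen_interior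

variable [ConnectedSpace X]

theorem isSubcontinuum_univ : IsSubcontinuum (univ : Set X) :=
  ⟨isCompact_univ, isConnected_univ⟩

/-- Otherwise the `D**` property, applied to a small continuum containing `a` and to a continuum
`P ⊆ T \ B`, yields a continuum `C` which does not contain `P`, although together with the small
continuum, `B` and the nowhere dense `T` it covers `X`. -/
theorem IsDStarStar.subset_of_interior_eq_empty (hD : IsDStarStar X) {a b : X}
    (hirr : IsIrreducibleBetween X a b) {B T : Set X} (hB : IsSubcontinuum B) (hb : b ∈ B)
    (hT : IsSubcontinuum T) (hT0 : interior T = ∅) (hTB : (T ∩ B).Nonempty) (haT : a ∉ T)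
    (haB : a ∉ B) : T ⊆ B := by
  intro x hxT
  by_contra hxB
  obtain ⟨y, hyT, hyB⟩ := hTB
  obtain ⟨P, hPT, hP, hPn, -⟩ := hT.exists_nontrivial_subset
    ⟨x, hxT, y, hyT, fun h => hxB (h ▸ hyB)⟩ hB.1.isClosed.isOpen_compl hxT hxB
  obtain ⟨Q, hQ, hQc, hQn, haQ⟩ := isSubcontinuum_univ.exists_nontrivial_subset (x := a)
    ⟨a, mem_univ _, y, mem_univ _, fun h => haT (h ▸ hyT)⟩
    (hT.1.isClosed.union hB.1.isClosed).isOpen_compl (mem_univ a) (fun h => h.elim haT haB)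
  obtain ⟨C, hC, ⟨q, hqQ, hqC⟩, ⟨p, hpP, hpC⟩, z, hzP, hzC⟩ := hD Q P hQc hQn hP hPn
    (disjoint_left.2 fun z hz hz' => (hQ hz).2 (Or.inl (hPT hz').1))
  have hTBc : IsSubcontinuum (T ∪ B) := hT.union hB ⟨y, hyT, hyB⟩
  have h1 : IsSubcontinuum ((Q ∪ C) ∪ (T ∪ B)) :=
    (hQc.union hC ⟨q, hqQ, hqC⟩).union hTBc ⟨p, Or.inr hpC, Or.inl (hPT hpP).1⟩
  have h2 := hirr _ h1 (Or.inl (Or.inl haQ)) (Or.inr (Or.inr hb))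
  have h3 : Q ∪ C ∪ B = univ := by
    have h := interior_union_isClosed_of_interior_empty
      ((hQc.1.isClosed.union hC.1.isClosed).union hB.1.isClosed) hT0
    rw [union_assoc, union_comm B T, h2, interior_univ] at h
    exact univ_subset_iff.1 (h ▸ interior_subset)
  rcases (h3 ▸ mem_univ z : z ∈ Q ∪ C ∪ B) with (h | h) | h
  · exact (hQ h).2 (Or.inl (hPT hzP).1)
  · exact hzC h
  · exact (hPT hzP).2 h

theorem IsDStarStar.interior_nonempty (hD : IsDStarStar X) {a b : X}
    (hirr : IsIrreducibleBetween X a b) {T : Set X} (hT : IsSubcontinuum T)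
    (hTn : T.Nontrivial) : (interior T).Nonempty := by
  by_contra h0
  rw [not_nonempty_iff_eq_empty] at h0
  -- Shrink `T` so that it misses `a` and `b`.
  obtain ⟨x, hxT, hxa⟩ := hTn.exists_ne a
  obtain ⟨T₁, hT₁, hT₁c, hT₁n, -⟩ :=
    hT.exists_nontrivial_subset hTn isOpen_compl_singleton hxT hxa
  obtain ⟨x', hxT', hxb⟩ := hT₁n.exists_ne b
  obtain ⟨S, hS, hSc, hSn, -⟩ :=
    hT₁c.exists_nontrivial_subset hT₁n isOpen_compl_singleton hxT' hxb
  have hS0 : interior S = ∅ :=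
    subset_empty_iff.1 (h0 ▸ interior_mono fun z hz => (hT₁ (hS hz).1).1)
  have haS : a ∉ S := fun h => (hT₁ (hS h).1).2 rfl
  have hbS : b ∉ S := fun h => (hS h).2 rfl
  obtain ⟨Q, hQ, hQc, hQn, haQ⟩ := isSubcontinuum_univ.exists_nontrivial_subset (x := a)
    ⟨a, mem_univ _, x, mem_univ _, Ne.symm hxa⟩ hSc.1.isClosed.isOpen_compl (mem_univ a) haS
  obtain ⟨C, hC, ⟨q, hqQ, hqC⟩, ⟨p, hpS, hpC⟩, z, hzS, hzC⟩ := hD Q S hQc hQn hSc hSn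
    (disjoint_left.2 fun z hz hz' => (hQ hz).2 hz')
  have hA : IsSubcontinuum (Q ∪ C) := hQc.union hC ⟨q, hqQ, hqC⟩
  have hz : z ∈ Q ∪ C := by
    by_cases hb : b ∈ Q ∪ C
    · rw [hirr _ hA (Or.inl haQ) hb]
      exact mem_univ z
    · exact hD.subset_of_interior_eq_empty hirr.symm hA (Or.inl haQ) hSc hS0 ⟨p, hpS, Or.inr hpC⟩
        hbS hb hzS
  exact hz.elim (fun h => (hQ h).2 hzS) hzC

/-! ### Every point cuts the continuum into two subcontinua -/

theorem IsIrreducibleBetween.isSubcontinuum_closure_compl {a b : X}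
    (hirr : IsIrreducibleBetween X a b) {B : Set X} (hB : IsSubcontinuum B) (hb : b ∈ B)
    (ha : a ∉ B) : IsSubcontinuum (closure Bᶜ) := by
  have h := isSubcontinuum_univ.isPreconnected_diff hB (subset_univ B) hb (mem_univ a)
    fun C hC _ hbC haC => hirr C hC haC hbC
  rw [← compl_eq_univ_sdiff] at h
  exact ⟨isClosed_closure.isCompact, IsConnected.closure ⟨⟨a, ha⟩, h⟩⟩

/-- If `p` and `q` were two points of the boundary of `B`, then a small continuum `P` through `p`
outside `B` could be removed: the closure of the complement of `B ∪ P` still contains `a` and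
meets `B` in `q`, but misses the interior of `P`. -/
theorem IsIrreducibleBetween.closure_compl_inter_eq_singleton {a b : X}
    (hirr : IsIrreducibleBetween X a b)
    (hint : ∀ T : Set X, IsSubcontinuum T → T.Nontrivial → (interior T).Nonempty)
    {B : Set X} (hB : IsSubcontinuum B) (hb : b ∈ B) (ha : a ∉ B) :
    ∃ p, closure Bᶜ ∩ B = {p} := by
  have hA := hirr.isSubcontinuum_closure_compl hB hb ha
  have haA : a ∈ closure Bᶜ := subset_closure ha
  have hne : (closure Bᶜ ∩ B).Nonempty := by
    by_contra h
    rw [not_nonempty_iff_eq_empty] at h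
    have := isPreconnected_iff_subset_of_disjoint_closed.1
      (isPreconnected_univ (α := X)) (closure Bᶜ) B isClosed_closure hB.1.isClosed
      (fun x _ => (em (x ∈ B)).symm.imp (fun h => subset_closure h) id) (by rw [h, inter_empty])
    rcases this with h' | h'
    · have : b ∈ closure Bᶜ ∩ B := ⟨h' (mem_univ b), hb⟩
      rw [h] at this
      exact this
    · exact ha (h' (mem_univ a))
  obtain ⟨p, hpA, hpB⟩ := hne
  refine ⟨p, Subset.antisymm ?_ (singleton_subset_iff.2 ⟨hpA, hpB⟩)⟩
  rintro q ⟨hqA, hqB⟩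
  by_contra hqp
  have hqp : q ≠ p := hqp
  have hpa : p ≠ a := fun h => ha (h ▸ hpB)
  obtain ⟨P, hPA, hP, hPn, hpP⟩ := hA.exists_nontrivial_subset
    ⟨p, hpA, q, hqA, hqp.symm⟩ (isOpen_compl_singleton.inter isOpen_compl_singleton) hpA
    (show p ∈ ({q}ᶜ ∩ {a}ᶜ : Set X) from ⟨hqp.symm, hpa⟩)
  have hqP : q ∉ P := fun h => (hPA h).2.1 rfl
  have haP : a ∉ P := fun h => (hPA h).2.2 rfl
  have hA' := hirr.isSubcontinuum_closure_compl (hB.union hP ⟨p, hpB, hpP⟩) (Or.inl hb)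
    (fun h => h.elim ha haP)
  have hq : q ∈ closure (B ∪ P)ᶜ := by
    rw [compl_union, inter_comm, mem_closure_iff]
    intro o ho hqo
    obtain ⟨w, hw, hwB⟩ := mem_closure_iff.1 hqA (o ∩ Pᶜ) (ho.inter hP.1.isClosed.isOpen_compl)
      ⟨hqo, hqP⟩
    exact ⟨w, hw.1, hw.2, hwB⟩
  have huniv := hirr _ (hA'.union hB ⟨q, hq, hqB⟩)
    (Or.inl (subset_closure fun h => h.elim ha haP)) (Or.inr hb)
  obtain ⟨w, hw⟩ := hint P hP hPn
  obtain ⟨v, hvP, hvB⟩ := mem_closure_iff.1 (hPA (interior_subset hw)).1 _ isOpen_interior hw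
  rcases (huniv ▸ mem_univ v : v ∈ closure (B ∪ P)ᶜ ∪ B) with h | h
  · obtain ⟨u, hu, hu'⟩ := mem_closure_iff.1 h _ isOpen_interior hvP
    exact hu' (Or.inr (interior_subset hu))
  · exact hvB h

/-- Zorn's lemma gives a subcontinuum irreducible between two given points. -/
theorem exists_minimal_isSubcontinuum (p b : X) :
    ∃ B, Minimal (fun C : Set X => IsSubcontinuum C ∧ p ∈ C ∧ b ∈ C) B := by
  obtain ⟨B, -, hB⟩ := zorn_superset_nonempty {C : Set X | IsSubcontinuum C ∧ p ∈ C ∧ b ∈ C}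
    (fun c hc hchain hne => ⟨⋂₀ c,
      ⟨IsSubcontinuum.sInter_of_isChain hne hchain fun C hC => (hc hC).1,
        fun C hC => (hc hC).2.1, fun C hC => (hc hC).2.2⟩,
      fun s hs => sInter_subset_of_mem hs⟩) univ ⟨isSubcontinuum_univ, mem_univ _, mem_univ _⟩
  exact ⟨B, hB⟩

/-- `A` and `B` are subcontinua containing `a` and `b` respectively, which together cover the
space and meet exactly in `p`. When the space is an arc from `a` to `b`, these are the subarcs
`[a, p]` and `[p, b]`. -/
structure IsCut (a b p : X) (A B : Set X) : Prop where
  left : IsSubcontinuum A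
  right : IsSubcontinuum B
  mem_left : a ∈ A
  mem_right : b ∈ B
  union_eq : A ∪ B = univ
  inter_eq : A ∩ B = {p}

theorem IsIrreducibleBetween.exists_isCut {a b : X} (hab : a ≠ b)
    (hirr : IsIrreducibleBetween X a b)
    (hint : ∀ T : Set X, IsSubcontinuum T → T.Nontrivial → (interior T).Nonempty) (p : X) :
    ∃ A B, IsCut a b p A B := by
  by_cases hpa : p = a
  · subst hpa
    exact ⟨{p}, univ, isSubcontinuum_singleton p, isSubcontinuum_univ, rfl, mem_univ _,
      union_univ _, inter_univ _⟩
  by_cases hpb : p = b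
  · subst hpb
    exact ⟨univ, {p}, isSubcontinuum_univ, isSubcontinuum_singleton p, mem_univ _, rfl,
      univ_union _, univ_inter _⟩
  obtain ⟨B, hB⟩ := exists_minimal_isSubcontinuum p b
  obtain ⟨hBc, hp, hb⟩ := hB.prop
  have ha : a ∉ B := fun ha => by
    obtain ⟨E, hE, hbE, haE, O, -, -, ⟨o, ho⟩, hOE⟩ :=
      exists_isSubcontinuum_of_minimal hint hB ha (Ne.symm hpa) (Ne.symm hpb)
    rw [hirr E hE haE hbE] at hOE
    exact disjoint_left.1 hOE ho (mem_univ o)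
  have hA := hirr.isSubcontinuum_closure_compl hBc hb ha
  have haA : a ∈ closure Bᶜ := subset_closure ha
  obtain ⟨r, hr⟩ := hirr.closure_compl_inter_eq_singleton hint hBc hb ha
  have hrm : r ∈ closure Bᶜ ∩ B := hr ▸ rfl
  have hrp : r = p := by
    by_contra hrp
    obtain ⟨E, hE, hbE, hrE, O, hOB, hO, ⟨o, ho⟩, hOE⟩ :=
      exists_isSubcontinuum_of_minimal hint hB hrm.2 hrp (Ne.symm hpb)
    have hu := hirr _ (hA.union hE ⟨r, hrm.1, hrE⟩) (Or.inl haA) (Or.inr hbE)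
    rcases (hu ▸ mem_univ o : o ∈ closure Bᶜ ∪ E) with h | h
    · obtain ⟨u, hu, hu'⟩ := mem_closure_iff.1 h O hO ho
      exact hu' (hOB hu)
    · exact disjoint_left.1 hOE ho h
  refine ⟨closure Bᶜ, B, hA, hBc, haA, hb, ?_, hrp ▸ hr⟩
  exact eq_univ_of_forall fun x => (em (x ∈ B)).symm.imp (fun h => subset_closure h) id

end Irreducible

section Parametrization

open Set Topology

variable {X : Type*} [MetricSpace X]

/-! ### Initial segments are totally ordered and vary continuously -/

namespace IsCut

theorem swap {a b p : X} {A B : Set X} (h : IsCut a b p A B) : IsCut b a p B A :=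
  ⟨h.right, h.left, h.mem_right, h.mem_left, by rw [union_comm, h.union_eq],
    by rw [inter_comm, h.inter_eq]⟩

variable {a b p q : X} {A B A' B' : Set X}

theorem self_mem_left (h : IsCut a b p A B) : p ∈ A :=
  (h.inter_eq ▸ rfl : p ∈ A ∩ B).1

theorem self_mem_right (h : IsCut a b p A B) : p ∈ B :=
  h.swap.self_mem_left

theorem mem_or_mem (h : IsCut a b p A B) (x : X) : x ∈ A ∨ x ∈ B :=
  (h.union_eq ▸ mem_univ x : x ∈ A ∪ B)

theorem eq_of_mem (h : IsCut a b p A B) {x : X} (hA : x ∈ A) (hB : x ∈ B) : x = p :=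
  (h.inter_eq ▸ ⟨hA, hB⟩ : x ∈ ({p} : Set X))

/-- A connected set avoiding the cut point lies on one side of the cut. -/
theorem subset_or_subset (h : IsCut a b p A B) {S : Set X} (hS : IsPreconnected S) (hp : p ∉ S) :
    S ⊆ A ∨ S ⊆ B := by
  refine isPreconnected_iff_subset_of_disjoint_closed.1 hS A B h.left.1.isClosed
    h.right.1.isClosed (fun x _ => h.mem_or_mem x) ?_
  rw [h.inter_eq, inter_singleton_eq_empty]
  exact hp

theorem notMem_left (h : IsCut a b p A B) (h' : IsCut a b q A' B') (hq : q ∈ A) (hqp : q ≠ p) :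
    p ∉ A' := by
  intro hp
  have hqB : q ∉ B := fun hqB => hqp (h.eq_of_mem hq hqB)
  rcases h'.subset_or_subset h.right.2.isPreconnected hqB with hs | hs
  · exact hqB (h'.eq_of_mem (hs h.mem_right) h'.mem_right ▸ h.mem_right)
  · exact hqp (h'.eq_of_mem hp (hs h.self_mem_right)).symm

theorem left_subset_left (h : IsCut a b p A B) (h' : IsCut a b q A' B') (hq : q ∈ A) :
    A' ⊆ A ∨ q = p := by
  by_cases hqp : q = p
  · exact Or.inr hqp
  left
  refine (h.subset_or_subset h'.left.2.isPreconnected (h.notMem_left h' hq hqp)).resolve_right ?_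
  exact fun hs => hqp (h.eq_of_mem hq (hs h'.self_mem_left))

theorem mem_left_of_notMem_left (h : IsCut a b p A B) (h' : IsCut a b q A' B') (hq : q ∉ A) :
    p ∈ A' := by
  have hqp : q ≠ p := fun e => hq (e ▸ h.self_mem_left)
  exact (h'.mem_or_mem p).resolve_right
    (h.swap.notMem_left h'.swap ((h.mem_or_mem q).resolve_left hq) hqp)

end IsCut

/-- For `x` close to `p` on the side of `a`, only a small part of `A p` lies outside `A x`: if `P`
is a small continuum in `A p` containing `p` and another point `y`, then `A y ∪ P` covers `A p`. -/
theorem IsIrreducibleBetween.eventually_subset_union {a b : X} (hirr : IsIrreducibleBetween X a b)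
    {A B : X → Set X} (h : ∀ p, IsCut a b p (A p) (B p)) (p : X) {U : Set X} (hU : IsOpen U)
    (hp : p ∈ U) : ∀ᶠ x in 𝓝 p, x ∈ A p → A p ⊆ A x ∪ U := by
  by_cases hn : (A p).Nontrivial
  · obtain ⟨P, hPA, hP, hPn, hpP⟩ :=
      (h p).left.exists_nontrivial_subset hn hU (h p).self_mem_left hp
    obtain ⟨y, hyP, hyp⟩ := hPn.exists_ne p
    have hpy : p ∉ A y := (h p).notMem_left (h y) (hPA hyP).1 hyp
    have huniv := hirr _ (((h y).left.union hP ⟨y, (h y).self_mem_left, hyP⟩).union (h p).right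
      ⟨p, Or.inr hpP, (h p).self_mem_right⟩) (Or.inl (Or.inl (h y).mem_left)) (Or.inr (h p).mem_right)
    filter_upwards [(h y).left.1.isClosed.isOpen_compl.mem_nhds hpy] with x hx hxp z hz
    have hyx : A y ⊆ A x := by
      have hy : y ∈ A x := (h y).mem_left_of_notMem_left (h x) hx
      exact ((h x).left_subset_left (h y) hy).elim id fun e => e ▸ Subset.rfl
    rcases (huniv ▸ mem_univ z : z ∈ A y ∪ P ∪ B p) with (h1 | h1) | h1
    · exact Or.inl (hyx h1)
    · exact Or.inr (hPA h1).2
    · exact Or.inr ((h p).eq_of_mem hz h1 ▸ hp)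
  · refine Filter.Eventually.of_forall fun x hx z hz => Or.inr ?_
    exact not_nontrivial_iff.1 hn (h p).self_mem_left hz ▸ hp

/-- Near `p`, the segments `A x` and `A p` differ only inside a prescribed neighbourhood of `p`. -/
theorem IsIrreducibleBetween.eventually_subset_and_subset {a b : X}
    (hirr : IsIrreducibleBetween X a b) {A B : X → Set X} (h : ∀ p, IsCut a b p (A p) (B p)) (p : X)
    {U : Set X} (hU : IsOpen U) (hp : p ∈ U) :
    ∀ᶠ x in 𝓝 p, A p ⊆ A x ∪ U ∧ A x ⊆ A p ∪ U := by
  filter_upwards [hirr.eventually_subset_union h p hU hp,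
    hirr.symm.eventually_subset_union (fun q => (h q).swap) p hU hp, hU.mem_nhds hp] with x hA hB hxU
  rcases eq_or_ne x p with rfl | hxp
  · exact ⟨subset_union_left, subset_union_left⟩
  by_cases hx : x ∈ A p
  · exact ⟨hA hx, (((h p).left_subset_left (h x) hx).resolve_right hxp).trans subset_union_left⟩
  have hpx : p ∈ A x := (h p).mem_left_of_notMem_left (h x) hx
  refine ⟨(((h x).left_subset_left (h p) hpx).resolve_right hxp.symm).trans subset_union_left, ?_⟩
  intro z hz
  rcases (h p).mem_or_mem z with h1 | h1
  · exact Or.inl h1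
  rcases hB (((h p).mem_or_mem x).resolve_left hx) h1 with h2 | h2
  · exact Or.inr ((h x).eq_of_mem hz h2 ▸ hxU)
  · exact Or.inr h2

theorem infDist_le_infDist_add {S T : Set X} {p y z : X} {ε : ℝ} (hS : S.Nonempty)
    (h : S ⊆ T ∪ Metric.ball p ε) (hyT : y ∈ T) (hy : y ∈ Metric.ball p ε) :
    Metric.infDist z T ≤ Metric.infDist z S + 2 * ε := by
  rw [← sub_le_iff_le_add, Metric.le_infDist hS]
  intro w hw
  rw [Metric.mem_ball] at hy
  rcases h hw with h1 | h1
  · have := Metric.infDist_le_dist_of_mem (x := z) h1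
    linarith [dist_nonneg (x := y) (y := p)]
  · have := Metric.infDist_le_dist_of_mem (x := z) hyT
    rw [Metric.mem_ball] at h1
    linarith [dist_triangle z w y, dist_triangle_right w y p]

theorem IsIrreducibleBetween.continuous_infDist {a b : X} (hirr : IsIrreducibleBetween X a b)
    {A B : X → Set X} (h : ∀ p, IsCut a b p (A p) (B p)) (z : X) :
    Continuous fun x => Metric.infDist z (A x) := by
  rw [continuous_iff_continuousAt]
  intro p
  rw [ContinuousAt, Metric.tendsto_nhds]
  intro ε hε
  have hε' : 0 < ε / 3 := by positivity
  filter_upwards [hirr.eventually_subset_and_subset h p Metric.isOpen_ball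
    (Metric.mem_ball_self hε'), Metric.ball_mem_nhds p hε'] with x hx hxp
  have h1 := infDist_le_infDist_add (z := z) ⟨p, (h p).self_mem_left⟩ hx.1 (h x).self_mem_left hxp
  have h2 := infDist_le_infDist_add (z := z) ⟨x, (h x).self_mem_left⟩ hx.2 (h p).self_mem_left
    (Metric.mem_ball_self hε')
  rw [Real.dist_eq, abs_lt]
  constructor <;> linarith

/-! ### A continuous injection into the real line -/

/-- The function `x ↦ ∑ₙ 2⁻ⁿ infDist zₙ (A x)`, for a dense sequence `zₙ`, is continuous, and it is
injective because the segments `A x` are closed and strictly nested. -/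
theorem IsIrreducibleBetween.exists_continuous_injective [CompactSpace X] {a b : X}
    (hirr : IsIrreducibleBetween X a b) {A B : X → Set X}
    (h : ∀ p, IsCut a b p (A p) (B p)) : ∃ f : X → ℝ, Continuous f ∧ Function.Injective f := by
  have : Nonempty X := ⟨a⟩
  let z := TopologicalSpace.denseSeq X
  have hz : DenseRange z := TopologicalSpace.denseRange_denseSeq X
  let g : ℕ → X → ℝ := fun n x => (1 / 2 : ℝ) ^ n * Metric.infDist (z n) (A x)
  have hg0 : ∀ n x, 0 ≤ g n x := fun n x => mul_nonneg (by positivity) Metric.infDist_nonneg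
  have hgu : ∀ n x, g n x ≤ (1 / 2 : ℝ) ^ n * Metric.diam (univ : Set X) := fun n x =>
    mul_le_mul_of_nonneg_left ((Metric.infDist_le_dist_of_mem (h x).self_mem_left).trans
      (Metric.dist_le_diam_of_mem isCompact_univ.isBounded (mem_univ _) (mem_univ _)))
      (by positivity)
  have hu : Summable fun n : ℕ => (1 / 2 : ℝ) ^ n * Metric.diam (univ : Set X) :=
    summable_geometric_two.mul_right _
  have hs : ∀ x, Summable fun n => g n x := fun x =>
    Summable.of_nonneg_of_le (fun n => hg0 n x) (fun n => hgu n x) hu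
  refine ⟨fun x => ∑' n, g n x, continuous_tsum
    (fun n => continuous_const.mul (hirr.continuous_infDist h (z n))) hu
    (fun n x => by rw [Real.norm_of_nonneg (hg0 n x)]; exact hgu n x), ?_⟩
  have key : ∀ p q, q ∈ A p → q ≠ p → ∑' n, g n p < ∑' n, g n q := by
    intro p q hq hqp
    have hpq : p ∉ A q := (h p).notMem_left (h q) hq hqp
    have hsub : A q ⊆ A p := ((h p).left_subset_left (h q) hq).resolve_right hqp
    have hne : (A q).Nonempty := ⟨q, (h q).self_mem_left⟩
    have hδ : 0 < Metric.infDist p (A q) :=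
      ((h q).left.1.isClosed.notMem_iff_infDist_pos hne).1 hpq
    obtain ⟨n, hn⟩ := hz.exists_dist_lt p (half_pos hδ)
    refine Summable.tsum_lt_tsum (i := n) (fun m => mul_le_mul_of_nonneg_left
      (Metric.infDist_le_infDist_of_subset hsub hne) (by positivity)) ?_ (hs p) (hs q)
    refine mul_lt_mul_of_pos_left ?_ (by positivity)
    have h1 := Metric.infDist_le_dist_of_mem (x := z n) (h p).self_mem_left
    have h2 := Metric.infDist_le_infDist_add_dist (s := A q) (x := p) (y := z n)
    rw [dist_comm] at h1
    linarith
  intro p q hpq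
  by_contra hne
  by_cases hq : q ∈ A p
  · exact (key p q hq (Ne.symm hne)).ne hpq
  · exact (key q p ((h p).mem_left_of_notMem_left (h q) hq) hne).ne hpq.symm

theorem isArc_of_continuous_injective [CompactSpace X] [ConnectedSpace X] [Nontrivial X]
    {f : X → ℝ} (hf : Continuous f) (hinj : Function.Injective f) : IsArc X := by
  have hr : range f = Icc (sInf (range f)) (sSup (range f)) :=
    eq_Icc_of_connected_compact (isConnected_range hf) (isCompact_range hf)
  have hlt : sInf (range f) < sSup (range f) := by
    obtain ⟨x, y, hxy⟩ := exists_pair_ne X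
    by_contra hle
    have hs : (range f).Subsingleton := by
      rw [hr]
      exact subsingleton_Icc_of_ge (not_lt.1 hle)
    exact hxy (hinj (hs (mem_range_self x) (mem_range_self y)))
  exact ⟨((hf.isClosedEmbedding hinj).isEmbedding.toHomeomorph.trans
    (Homeomorph.setCongr hr)).trans (iccHomeoI _ _ hlt)⟩

end Parametrization

theorem theorem3p1 (X : Type*) [MetricSpace X] [CompactSpace X] [ConnectedSpace X]
    (hirr : IsIrreducibleContinuum X) (hD : IsDStarStar X) : IsArc X := by
  obtain ⟨_, a, b, hab⟩ := hirr
  have hne : a ≠ b := by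
    rintro rfl
    have h := hab {a} (isSubcontinuum_singleton a) rfl rfl
    obtain ⟨x, hx⟩ := exists_ne a
    exact hx (h ▸ Set.mem_univ x : x ∈ ({a} : Set X))
  choose A B h using hab.exists_isCut hne fun _ hT hTn => hD.interior_nonempty hab hT hTn
  obtain ⟨f, hf, hinj⟩ := hab.exists_continuous_injective h
  exact isArc_of_continuous_injective hf hinj
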